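/- Let $k$ be a constant. An instance of Boolean $k$-CSP consists of $n$ variables $V=\{v_1,\dots,v_n\}$ and a set of constraints, where each constraint $C$ is a $k$-element subset of $V$ together with a predicate $P_C:\{0,1\}^C\to\{\mathrm{sat},\mathrm{unsat}\}$, and each $k$-subset of $V$ carries at most one constraint. An assignment $\alpha:V\to\{0,1\}$ satisfies the instance if $P_C(\alpha|_C)=\mathrm{sat}$ for every constraint $C$. The instance is complete if every $k$-subset of $V$ carries exactly one constraint and every predicate $P_C$ takes the value $\mathrm{unsat}$ at least once. Theorem. For every constant $k$ there is an algorithm (a multi-tape Turing machine) that decides in time $n^{O(\log n)}$ whether a given complete instance of Boolean $k$-CSP on $n$ variables is satisfiable; the constant in the exponent depends only on $k$. Moreover, there is an algorithm that, given such an instance, outputs the list of all its satisfying assignments, each exactly once, in time $n^{O(\log n)}$. -/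

import Mathlib

namespace CompleteCSP

/-- A constraint of arity `k` on the Boolean variables `v_0, …, v_{n-1}`: a set of exactly `k`
variables with a predicate on the partial assignments to these variables
(`true` is "satisfied", `false` is "unsatisfied"). -/
structure Constraint (n k : ℕ) where
  scope : Finset (Fin n)
  card_scope : scope.card = k
  pred : (scope → Bool) → Bool

/-- An instance of Boolean `k`-CSP: a number `n` of variables and a list of constraints on them,
with at most one constraint on each set of variables. The list order is the (arbitrary) order in
which the constraints are written in the input. -/
structure Instance (k : ℕ) where
  n : ℕ
  constraints : List (Constraint n k)
  nodup_scopes : (constraints.map Constraint.scope).Nodup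

namespace Constraint

variable {n k : ℕ}

/-- The assignment `α` satisfies the constraint: the predicate accepts the restriction of `α`. -/
def Satisfies (C : Constraint n k) (α : Fin n → Bool) : Prop :=
  C.pred (fun v => α v) = true

/-- The characteristic vector of the scope, of length `n`. -/
def scopeBits (C : Constraint n k) : List Bool :=
  List.ofFn fun v : Fin n => decide (v ∈ C.scope)

/-- The truth table of the predicate, of length `2 ^ k`: entry `i` is the value at the partial
assignment that gives the `j`-th smallest variable of the scope (counted from `0`) the `j`-th
binary digit of `i`. -/
def table (C : Constraint n k) : List Bool :=
  List.ofFn fun i : Fin (2 ^ k) =>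
    C.pred fun v => (i : ℕ).testBit (C.scope.filter (· < (v : Fin n))).card

end Constraint

/-- A word of bits followed by the separator symbol `none`. -/
def encodeBits (w : List Bool) : List (Option Bool) :=
  w.map some ++ [none]

/-- A list of assignments, written one after the other. -/
def encodeAssignments {n : ℕ} (L : List (Fin n → Bool)) : List (Option Bool) :=
  L.flatMap fun α => encodeBits (List.ofFn α)

namespace Instance

variable {k : ℕ}

/-- The instance is complete: every `k`-set of variables carries exactly one constraint, and every
constraint rejects at least one partial assignment to its scope. -/
def Complete (I : Instance k) : Prop :=
  (∀ S : Finset (Fin I.n), S.card = k → ∃! C, C ∈ I.constraints ∧ C.scope = S) ∧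
    ∀ C ∈ I.constraints, ∃ σ, C.pred σ = false

/-- The assignment `α` satisfies all the constraints. -/
def Satisfies (I : Instance k) (α : Fin I.n → Bool) : Prop :=
  ∀ C ∈ I.constraints, C.Satisfies α

/-- Some assignment satisfies all the constraints. -/
def Satisfiable (I : Instance k) : Prop :=
  ∃ α, I.Satisfies α

/-- The input word over the alphabet `{0, 1, separator}`: the number of variables in unary, then,
for each constraint, the characteristic vector of its scope and its truth table. -/
def encode (I : Instance k) : List (Option Bool) :=
  encodeBits (List.replicate I.n true) ++
    I.constraints.flatMap fun C => encodeBits C.scopeBits ++ encodeBits C.table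

end Instance

/-- The Turing machine `M`, started on the input word `x`, halts with output word `y` after at
most `t` steps. -/
def OutputsWithin {Γ₀ Γ₁ : Type} (M : Turing.TM2ComputableAux Γ₀ Γ₁) (x : List Γ₀) (y : List Γ₁)
    (t : ℕ) : Prop :=
  Nonempty (Turing.TM2OutputsInTime M.tm (x.map M.inputAlphabet.invFun)
    (some (y.map M.outputAlphabet.invFun)) t)

/-- `T n` is `n ^ O(log n)`. -/
def IsPowBigOLog (T : ℕ → ℕ) : Prop :=
  ∃ c : ℝ, ∀ n : ℕ, 2 ≤ n → (T n : ℝ) ≤ (n : ℝ) ^ (c * Real.log n)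

end CompleteCSP

/-!
Give the variables values in the order `v_0, v_1, …`, and call a partial assignment to the first
`i` variables good if it violates no constraint whose scope lies in these variables. Regard the
good assignments to the first `i` variables as a family of subsets of the set of variables. If the
instance is complete, this family shatters no `k`-set: the variables of a shattered set are among
the first `i`, and the constraint on a shattered `k`-set rejects some assignment to its scope,
which is then the restriction of no good assignment (`Instance.card_le_of_shatters`). Hence its VC
dimension is at most `k`, and by the Sauer-Shelah lemma the number of good assignments to the
first `i` variables is at most `∑ j ≤ k, n.choose j`, a polynomial in `n`
(`Instance.length_leaves_le`).

So the depth-first search that extends good partial assignments by one variable at a time has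
polynomially many nodes (`nodes_le`, `Instance.nodes_good_le`). It meets every satisfying
assignment exactly once, since restrictions of good assignments are good (`mem_leaves`,
`nodup_leaves`), and checking one partial assignment takes time linear in the length of the input.
The running time is therefore even polynomial in `n` (`solverTime`), which is less than
`n ^ O(log n)`.

To write down the Turing machines, a small language of structured stack programs is compiled to
`Turing.TM2`. The predicate `Runs` states the effect of a program together with a time bound, and
has a rule for each construct of the language; loops are treated by `LoopSteps`. The machine keeps
the current partial assignment on a stack. To check it (`runs_check`), each scope is read along
with the values of the variables, which yields the index of an entry of the truth table; as `k` is
a constant, this index fits into the finite control. The search itself is `runs_solver`, where the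
way in which satisfying assignments are processed is a parameter: the decision machine replaces
the answer `false` by `true`, and the listing machine copies the assignment to the output.
-/

namespace CompleteCSP

/-! ### Structured programs for stack machines -/

namespace StackProgram

open Turing

/-- The stacks of a machine: work stacks indexed by `ι` with symbols in `A`, and one output stack
(index `none`) with symbols in `R`. -/
def Alphabet (ι A R : Type) : Option ι → Type
  | some _ => A
  | none => R

/-- A memory state: the register in the finite control, the work stacks and the output stack
(the head of a list is the top of the stack). -/
@[ext]
structure State (ι A R σ : Type) where
  reg : σ
  work : ι → List A
  out : List R

variable {ι A R σ : Type}

/-- All stacks of a memory state, in the form used by `Turing.TM2`. -/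
def State.stacks (s : State ι A R σ) : ∀ k, List (Alphabet ι A R k)
  | some i => s.work i
  | none => s.out

/-- Elementary instructions. A `push` whose argument evaluates to `none` does nothing. -/
inductive Op (ι A R σ : Type) where
  | push (i : ι) (g : σ → Option A)
  | pop (i : ι) (g : σ → Option A → σ)
  | emit (g : σ → Option R)
  | drop
  | load (g : σ → σ)

/-- Structured programs. The instructions in a conditional or a loop are executed
before each evaluation of its condition, in the same step of the machine. -/
inductive Prog (ι A R σ : Type) where
  | block (l : List (Op ι A R σ))
  | seq (p q : Prog ι A R σ)
  | ite (l : List (Op ι A R σ)) (c : σ → Bool) (p q : Prog ι A R σ)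
  | loop (l : List (Op ι A R σ)) (c : σ → Bool) (p : Prog ι A R σ)

section Semantics

variable [DecidableEq ι]

/-- The effect of an instruction. -/
def Op.run : Op ι A R σ → State ι A R σ → State ι A R σ
  | .push i g, s => ⟨s.reg, Function.update s.work i ((g s.reg).toList ++ s.work i), s.out⟩
  | .pop i g, s => ⟨g s.reg (s.work i).head?, Function.update s.work i (s.work i).tail, s.out⟩
  | .emit g, s => ⟨s.reg, s.work, (g s.reg).toList ++ s.out⟩
  | .drop, s => ⟨s.reg, s.work, s.out.tail⟩
  | .load g, s => ⟨g s.reg, s.work, s.out⟩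

/-- The effect of a list of instructions. -/
def runOps : List (Op ι A R σ) → State ι A R σ → State ι A R σ
  | [], s => s
  | a :: l, s => runOps l (a.run s)

end Semantics

/-! ### Compilation to Turing machines -/

section Compile

variable {Λ : Type}

/-- Jump to a label; the label `none` halts. -/
def jump : Option Λ → TM2.Stmt (Alphabet ι A R) Λ σ
  | some l => .goto fun _ => l
  | none => .halt

section

variable [DecidableEq ι]

theorem stepAux_jump (x : Option Λ) (s : State ι A R σ) :
    TM2.stepAux (jump x) s.reg s.stacks = ⟨x, s.reg, s.stacks⟩ := by
  cases x <;> rfl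

/-- `u` steps of the machine `m` lead from `a` to `b`. -/
def Reaches (m : Λ → TM2.Stmt (Alphabet ι A R) Λ σ) (a b : TM2.Cfg (Alphabet ι A R) Λ σ)
    (u : ℕ) : Prop :=
  (flip bind (TM2.step m))^[u] (some a) = some b

theorem Reaches.trans {m : Λ → TM2.Stmt (Alphabet ι A R) Λ σ}
    {a b c : TM2.Cfg (Alphabet ι A R) Λ σ} {u w : ℕ} (h : Reaches m a b u)
    (h' : Reaches m b c w) : Reaches m a c (u + w) := by
  unfold Reaches at *
  rw [add_comm, Function.iterate_add_apply, h, h']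

theorem Reaches.single {m : Λ → TM2.Stmt (Alphabet ι A R) Λ σ} {a : Λ} {s : State ι A R σ}
    {b : TM2.Cfg (Alphabet ι A R) Λ σ} (h : TM2.stepAux (m a) s.reg s.stacks = b) :
    Reaches m ⟨some a, s.reg, s.stacks⟩ b 1 := by
  change some _ = _
  rw [h]

end

variable [Inhabited A] [Inhabited R]

/-- An instruction followed by the statement `q`. -/
def Op.stmt (q : TM2.Stmt (Alphabet ι A R) Λ σ) : Op ι A R σ → TM2.Stmt (Alphabet ι A R) Λ σ
  | .push i g => .branch (fun v => (g v).isSome)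
      (.push (some i) (fun v => ((g v).getD default : A)) q) q
  | .pop i g => .pop (some i) g q
  | .emit g => .branch (fun v => (g v).isSome)
      (.push none (fun v => ((g v).getD default : R)) q) q
  | .drop => .pop none (fun v _ => v) q
  | .load g => .load g q

/-- A list of instructions followed by the statement `q`. -/
def opsStmt (q : TM2.Stmt (Alphabet ι A R) Λ σ) : List (Op ι A R σ) →
    TM2.Stmt (Alphabet ι A R) Λ σ
  | [] => q
  | a :: l => a.stmt (opsStmt q l)

/-- The labels of the compiled program. -/
def Prog.Label : Prog ι A R σ → Type
  | .block _ => Unit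
  | .seq p q => p.Label ⊕ q.Label
  | .ite _ _ p q => Option (p.Label ⊕ q.Label)
  | .loop _ _ p => Option p.Label

instance Prog.fintypeLabel : (p : Prog ι A R σ) → Fintype p.Label
  | .block _ => inferInstanceAs (Fintype Unit)
  | .seq p q => @instFintypeSum _ _ p.fintypeLabel q.fintypeLabel
  | .ite _ _ p q => @instFintypeOption _ (@instFintypeSum _ _ p.fintypeLabel q.fintypeLabel)
  | .loop _ _ p => @instFintypeOption _ p.fintypeLabel

/-- The label at which a program starts. -/
def Prog.start : (p : Prog ι A R σ) → p.Label
  | .block _ => ()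
  | .seq p _ => Sum.inl p.start
  | .ite _ _ _ _ => none
  | .loop _ _ _ => none

/-- The code of a program whose labels are embedded by `e` in those of a machine, and which jumps
to `x` at its end. -/
def Prog.code : (p : Prog ι A R σ) → (p.Label → Λ) → Option Λ → p.Label →
    TM2.Stmt (Alphabet ι A R) Λ σ
  | .block l, _, x, _ => opsStmt (jump x) l
  | .seq p q, e, _, .inl a => p.code (fun b => e (.inl b)) (some (e (.inr q.start))) a
  | .seq _ q, e, x, .inr a => q.code (fun b => e (.inr b)) x a
  | .ite l c p q, e, _, none => opsStmt (.branch c (.goto fun _ => e (some (.inl p.start)))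
      (.goto fun _ => e (some (.inr q.start)))) l
  | .ite _ _ p _, e, x, some (.inl a) => p.code (fun b => e (some (.inl b))) x a
  | .ite _ _ _ q, e, x, some (.inr a) => q.code (fun b => e (some (.inr b))) x a
  | .loop l c p, e, x, none => opsStmt (.branch c (.goto fun _ => e (some p.start)) (jump x)) l
  | .loop _ _ p, e, _, some a => p.code (fun b => e (some b)) (some (e none)) a

variable [DecidableEq ι]

theorem stepAux_stmt (a : Op ι A R σ) (q : TM2.Stmt (Alphabet ι A R) Λ σ) (s : State ι A R σ) :
    TM2.stepAux (a.stmt q) s.reg s.stacks = TM2.stepAux q (a.run s).reg (a.run s).stacks := by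
  rcases s with ⟨v, f, o⟩
  cases a with
  | push i g =>
    rcases h : g v with _ | b
    · simp [Op.stmt, Op.run, h]
    · simp only [Op.stmt, Op.run, h, TM2.stepAux, Option.isSome_some, cond_true,
        Option.getD_some, Option.toList_some, List.singleton_append]
      congr 1
      funext k
      rcases k with _ | k
      · rfl
      · by_cases hk : k = i
        · subst hk; simp [State.stacks]; rfl
        · have : (some k : Option ι) ≠ some i := by simpa using hk
          simp [State.stacks, hk, this]; rfl
  | pop i g =>
    simp only [Op.stmt, Op.run, TM2.stepAux]
    congr 1
    funext k
    rcases k with _ | k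
    · rfl
    · by_cases hk : k = i
      · subst hk; simp [State.stacks]; rfl
      · have : (some k : Option ι) ≠ some i := by simpa using hk
        simp [State.stacks, hk, this]; rfl
  | emit g =>
    rcases h : g v with _ | b
    · simp [Op.stmt, Op.run, h]
    · simp only [Op.stmt, Op.run, h, TM2.stepAux, Option.isSome_some, cond_true,
        Option.getD_some, Option.toList_some, List.singleton_append]
      congr 1
      funext k
      rcases k with _ | k
      · simp [State.stacks]; rfl
      · simp [State.stacks]; rfl
  | drop =>
    simp only [Op.stmt, Op.run, TM2.stepAux]
    congr 1
    funext k
    rcases k with _ | k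
    · simp [State.stacks]; rfl
    · simp [State.stacks]; rfl
  | load g => rfl

theorem stepAux_opsStmt (l : List (Op ι A R σ)) (q : TM2.Stmt (Alphabet ι A R) Λ σ)
    (s : State ι A R σ) : TM2.stepAux (opsStmt q l) s.reg s.stacks =
      TM2.stepAux q (runOps l s).reg (runOps l s).stacks := by
  induction l generalizing s with
  | nil => rfl
  | cons a l ih => rw [opsStmt, stepAux_stmt, ih, runOps]

/-- The program `p`, started in the state `s`, ends in the state `s'` after at most `t` steps,
in whatever machine its code is placed. The bound on the steps need not be attained, so that time
bounds can be weakened at any point. -/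
def Runs (p : Prog ι A R σ) (s s' : State ι A R σ) (t : ℕ) : Prop :=
  ∀ (Λ : Type) (m : Λ → TM2.Stmt (Alphabet ι A R) Λ σ) (e : p.Label → Λ) (x : Option Λ),
    (∀ a, m (e a) = p.code e x a) →
      ∃ u ≤ t, Reaches m ⟨some (e p.start), s.reg, s.stacks⟩ ⟨x, s'.reg, s'.stacks⟩ u

theorem Runs.mono {p : Prog ι A R σ} {s s' : State ι A R σ} {t t' : ℕ} (h : Runs p s s' t)
    (ht : t ≤ t') : Runs p s s' t' := fun Λ m e x hm =>
  let ⟨u, hu, hr⟩ := h Λ m e x hm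
  ⟨u, hu.trans ht, hr⟩

theorem runs_block {l : List (Op ι A R σ)} {s s' : State ι A R σ} (hs : runOps l s = s') :
    Runs (.block l) s s' 1 := fun Λ m e x hm =>
  ⟨1, le_rfl, Reaches.single (by rw [hm, Prog.code, stepAux_opsStmt, stepAux_jump, hs])⟩

theorem Runs.seq {p q : Prog ι A R σ} {s s' s'' : State ι A R σ} {t t' : ℕ}
    (h : Runs p s s' t) (h' : Runs q s' s'' t') : Runs (.seq p q) s s'' (t + t') := by
  intro Λ m e x hm
  obtain ⟨u, hu, hr⟩ := h Λ m (fun b => e (.inl b)) _ fun a => hm (.inl a)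
  obtain ⟨u', hu', hr'⟩ := h' Λ m (fun b => e (.inr b)) x fun a => hm (.inr a)
  exact ⟨u + u', by omega, hr.trans hr'⟩

theorem Runs.ite_true {l : List (Op ι A R σ)} {c : σ → Bool} {p q : Prog ι A R σ}
    {s s₁ s' : State ι A R σ} {t : ℕ} (hs : runOps l s = s₁) (hc : c s₁.reg = true)
    (h : Runs p s₁ s' t) : Runs (.ite l c p q) s s' (1 + t) := by
  subst hs
  intro Λ m e x hm
  obtain ⟨u, hu, hr⟩ := h Λ m (fun b => e (some (.inl b))) x fun a => hm (some (.inl a))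
  refine ⟨1 + u, by omega, Reaches.trans (Reaches.single ?_) hr⟩
  erw [hm none]
  rw [Prog.code, stepAux_opsStmt, TM2.stepAux, hc]
  rfl

theorem Runs.ite_false {l : List (Op ι A R σ)} {c : σ → Bool} {p q : Prog ι A R σ}
    {s s₁ s' : State ι A R σ} {t : ℕ} (hs : runOps l s = s₁) (hc : c s₁.reg = false)
    (h : Runs q s₁ s' t) : Runs (.ite l c p q) s s' (1 + t) := by
  subst hs
  intro Λ m e x hm
  obtain ⟨u, hu, hr⟩ := h Λ m (fun b => e (some (.inr b))) x fun a => hm (some (.inr a))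
  refine ⟨1 + u, by omega, Reaches.trans (Reaches.single ?_) hr⟩
  erw [hm none]
  rw [Prog.code, stepAux_opsStmt, TM2.stepAux, hc]
  rfl

theorem runs_loop_exit {l : List (Op ι A R σ)} {c : σ → Bool} {p : Prog ι A R σ}
    {s s' : State ι A R σ} (hs : runOps l s = s') (hc : c s'.reg = false) :
    Runs (.loop l c p) s s' 1 := by
  subst hs
  intro Λ m e x hm
  refine ⟨1, le_rfl, Reaches.single ?_⟩
  erw [hm none]
  rw [Prog.code, stepAux_opsStmt, TM2.stepAux, hc, cond_false, stepAux_jump]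

/-- Repeating the loop `p` leads from `s` to `s'` within `t` steps, where both states are
taken at the head of the loop: every run from `s'` to an end of the loop extends to a run from `s`.
In this form, consecutive parts of a loop compose although the loop does not end in between. -/
def LoopSteps (p : Prog ι A R σ) (s s' : State ι A R σ) (t : ℕ) : Prop :=
  ∀ s'' t', Runs p s' s'' t' → Runs p s s'' (t + t')

theorem LoopSteps.refl (p : Prog ι A R σ) (s : State ι A R σ) : LoopSteps p s s 0 :=
  fun _ _ h => h.mono (by omega)

theorem LoopSteps.trans {p : Prog ι A R σ} {s s' s'' : State ι A R σ} {t t' : ℕ}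
    (h : LoopSteps p s s' t) (h' : LoopSteps p s' s'' t') : LoopSteps p s s'' (t + t') :=
  fun _ _ hr => (h _ _ (h' _ _ hr)).mono (by omega)

theorem LoopSteps.mono {p : Prog ι A R σ} {s s' : State ι A R σ} {t t' : ℕ}
    (h : LoopSteps p s s' t) (ht : t ≤ t') : LoopSteps p s s' t' :=
  fun _ _ hr => (h _ _ hr).mono (by omega)

theorem LoopSteps.exit {l : List (Op ι A R σ)} {c : σ → Bool} {p : Prog ι A R σ}
    {s s' s'' : State ι A R σ} {t : ℕ} (h : LoopSteps (.loop l c p) s s' t)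
    (hs : runOps l s' = s'') (hc : c s''.reg = false) : Runs (.loop l c p) s s'' (t + 1) :=
  h _ _ (runs_loop_exit hs hc)

theorem LoopSteps.single {l : List (Op ι A R σ)} {c : σ → Bool} {p : Prog ι A R σ}
    {s s₁ s' : State ι A R σ} {t : ℕ} (hs : runOps l s = s₁) (hc : c s₁.reg = true)
    (h : Runs p s₁ s' t) : LoopSteps (.loop l c p) s s' (1 + t) := by
  subst hs
  intro s'' t' h' Λ m e x hm
  obtain ⟨u, hu, hr⟩ := h Λ m (fun b => e (some b)) (some (e none)) fun a => hm (some a)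
  obtain ⟨u', hu', hr'⟩ := h' Λ m e x hm
  refine ⟨1 + u + u', by omega, (Reaches.trans (Reaches.single ?_) hr).trans hr'⟩
  erw [hm none]
  rw [Prog.code, stepAux_opsStmt, TM2.stepAux, hc]
  rfl

end Compile

end StackProgram

open StackProgram

/-! ### Checking a partial assignment -/

/-- The work stacks. The stack `input` holds the constraints that are still to be read, and `done`
those already read, reversed. The stack `path` holds a partial assignment, given by the values of
the first variables, with the latest variable on top; it is reversed to `front`, with variable `0`
on top, to be compared with the scopes. The height of `free` is the number of unassigned
variables. -/
inductive Stack where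
  | input | done | path | front | free
  deriving DecidableEq

instance : Fintype Stack :=
  ⟨{.input, .done, .path, .front, .free}, fun i => by cases i <;> simp⟩

/-- The work stacks with given contents. -/
def memory (a b c d e : List (Option Bool)) : Stack → List (Option Bool)
  | .input => a
  | .done => b
  | .path => c
  | .front => d
  | .free => e

section Memory

variable (a b c d e l : List (Option Bool))

@[simp] theorem memory_input : memory a b c d e .input = a := rfl
@[simp] theorem memory_done : memory a b c d e .done = b := rfl
@[simp] theorem memory_path : memory a b c d e .path = c := rfl
@[simp] theorem memory_front : memory a b c d e .front = d := rfl
@[simp] theorem memory_free : memory a b c d e .free = e := rfl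

@[simp] theorem update_input :
    Function.update (memory a b c d e) .input l = memory l b c d e := by
  funext i; cases i <;> rfl

@[simp] theorem update_done :
    Function.update (memory a b c d e) .done l = memory a l c d e := by
  funext i; cases i <;> rfl

@[simp] theorem update_path :
    Function.update (memory a b c d e) .path l = memory a b l d e := by
  funext i; cases i <;> rfl

@[simp] theorem update_front :
    Function.update (memory a b c d e) .front l = memory a b c l e := by
  funext i; cases i <;> rfl

@[simp] theorem update_free :
    Function.update (memory a b c d e) .free l = memory a b c d l := by
  funext i; cases i <;> rfl

end Memory

/-- The register in the finite control. The fields `cur` and `val` are the last symbols read from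
a stack in general and from `front` during the comparison with a scope, where `none` stands for an
empty stack. The field `ok` tells whether all constraints read so far are respected. For the
current constraint, `skip` tells whether its scope has an unassigned variable, `idx` is at first
the index of the relevant entry of the truth table, collected with the weight `wt` of the next
binary digit, and then the distance to this entry, which is stored in `entry`. The search goes
down if `enter` holds and up otherwise, as long as `run` holds. -/
structure Register (k : ℕ) where
  cur : Option (Option Bool)
  val : Option (Option Bool)
  ok : Bool
  skip : Bool
  entry : Option Bool
  idx : ZMod (2 ^ k)
  wt : ZMod (2 ^ k)
  enter : Bool
  run : Bool

noncomputable instance (k : ℕ) : Fintype (Register k) :=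
  Fintype.ofInjective
    (fun r => (r.cur, r.val, r.ok, r.skip, r.entry, r.idx, r.wt, r.enter, r.run)) (by
      rintro ⟨⟩ ⟨⟩ h
      simpa using h)

/-- The register before a partial assignment is checked. It is also the initial state. -/
def Register.down (k : ℕ) : Register k := ⟨none, none, true, false, none, 0, 1, true, true⟩

/-- The register after all extensions of a partial assignment have been searched. -/
def Register.up (k : ℕ) : Register k := { Register.down k with enter := false }

/-- The register at the end of the search. -/
def Register.finished (k : ℕ) : Register k := { Register.down k with run := false }

variable {k : ℕ} {R : Type}

/-- Pop a symbol into the register. -/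
def pop (i : Stack) : Op Stack (Option Bool) R (Register k) :=
  .pop i fun r x => { r with cur := x }

/-- Push the last symbol read, if any. -/
def pushCur (i : Stack) : Op Stack (Option Bool) R (Register k) :=
  .push i fun r => r.cur

/-- The last attempt to read a symbol was successful. -/
def Register.nonempty (r : Register k) : Bool := r.cur.isSome

/-- The last symbol read is a bit, not a separator. -/
def Register.isBit (r : Register k) : Bool := r.cur.join.isSome

/-- Move the content of a stack to another one, reversing it. -/
def move (i j : Stack) : Prog Stack (Option Bool) R (Register k) :=
  .loop [pop i] Register.nonempty (.block [pushCur j])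

/-- Take a bit of a scope, and the value of the variable, into account. -/
def Register.readScope (r : Register k) : Register k :=
  match r.cur, r.val with
  | some (some true), some (some b) =>
      { r with idx := r.idx + r.wt * (b.toNat : ZMod (2 ^ k)), wt := r.wt * 2 }
  | some (some true), _ => { r with skip := true }
  | _, _ => r

/-- Take an entry of a truth table into account. The index is a residue modulo `2 ^ k`, so it may
vanish again after further decrements; therefore only the first entry found is kept. -/
def Register.readTable (r : Register k) : Register k :=
  { r with
    entry := r.entry.or (if r.idx = 0 then r.cur.join else none)
    idx := r.idx - 1 }

/-- Draw the conclusion from a constraint. -/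
def Register.conclude (r : Register k) : Register k :=
  { r with
    ok := r.ok && (r.skip || r.entry == some true)
    skip := false
    entry := none
    idx := 0
    wt := 1 }

/-- Read a scope along with the partial assignment in `front`. -/
def scopeLoop : Prog Stack (Option Bool) R (Register k) :=
  .loop [pop .input] Register.isBit
    (.block [pushCur .done, .pop .front fun r x => { r with val := x },
      .push .path fun r => r.val, .load Register.readScope])

/-- Read a truth table. -/
def tableLoop : Prog Stack (Option Bool) R (Register k) :=
  .loop [pop .input] Register.isBit (.block [pushCur .done, .load Register.readTable])

/-- Read a constraint. -/
def constraintProg : Prog Stack (Option Bool) R (Register k) :=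
  .seq scopeLoop <| .seq (.block [pushCur .done]) <| .seq (move .path .front) <|
    .seq tableLoop (.block [pushCur .done, .load Register.conclude])

/-- Read all constraints. The symbol that is popped to see whether there is a further constraint is
put back before the constraint is read. -/
def constraintLoop : Prog Stack (Option Bool) R (Register k) :=
  .loop [pop .input, pushCur .input] Register.nonempty constraintProg

/-- Check whether the partial assignment in `path` respects all constraints; all stacks are
restored. -/
def check : Prog Stack (Option Bool) R (Register k) :=
  .seq (move .path .front) <| .seq constraintLoop <|
    .seq (move .done .input) (move .front .path)

variable [Inhabited R]

theorem runs_move {i j : Stack} (hij : i ≠ j) (l : List (Option Bool))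
    (r : Register k) (f : Stack → List (Option Bool)) (o : List R) (hf : f i = l) :
    Runs (move i j) ⟨r, f, o⟩
      ⟨{ r with cur := none },
        Function.update (Function.update f i []) j (l.reverse ++ f j), o⟩ (2 * l.length + 1) := by
  induction l generalizing r f with
  | nil =>
    refine runs_loop_exit ?_ rfl
    simp [runOps, Op.run, pop, hf, hij.symm]
  | cons x l ih =>
    have h := ih { r with cur := some x } (Function.update (Function.update f i l) j (x :: f j))
      (by simp [hij])
    have hw : Function.update (Function.update (Function.update (Function.update f i l) j
        (x :: f j)) i []) j (l.reverse ++ x :: f j) =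
        Function.update (Function.update f i []) j ((x :: l).reverse ++ f j) := by
      funext m
      by_cases h1 : m = j
      · simp [h1]
      · by_cases h2 : m = i
        · subst h2; simp [hij]
        · simp [h1, h2]
    rw [Function.update_self, hw] at h
    refine (LoopSteps.single
      (s₁ := ⟨{ r with cur := some x }, Function.update f i l, o⟩) ?_ rfl (runs_block ?_)
      _ _ h).mono (t := 1 + 1 + (2 * l.length + 1)) (by simp; omega)
    · simp [runOps, Op.run, pop, hf]
    · simp [runOps, Op.run, pushCur, hij.symm]

theorem runs_move_path_front (a b c d e : List (Option Bool)) (r : Register k) (o : List R) :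
    Runs (move .path .front) ⟨r, memory a b c d e, o⟩
      ⟨{ r with cur := none }, memory a b [] (c.reverse ++ d) e, o⟩ (2 * c.length + 1) := by
  simpa using runs_move (i := .path) (j := .front) (by decide) c r (memory a b c d e) o rfl

theorem runs_move_front_path (a b c d e : List (Option Bool)) (r : Register k) (o : List R) :
    Runs (move .front .path) ⟨r, memory a b c d e, o⟩
      ⟨{ r with cur := none }, memory a b (d.reverse ++ c) [] e, o⟩ (2 * d.length + 1) := by
  simpa using runs_move (i := .front) (j := .path) (by decide) d r (memory a b c d e) o rfl

theorem runs_move_done_input (a b c d e : List (Option Bool)) (r : Register k) (o : List R) :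
    Runs (move .done .input) ⟨r, memory a b c d e, o⟩
      ⟨{ r with cur := none }, memory (b.reverse ++ a) [] c d e, o⟩ (2 * b.length + 1) := by
  simpa using runs_move (i := .done) (j := .input) (by decide) b r (memory a b c d e) o rfl

/-- Some variable of the scope with characteristic vector `s` is not assigned a value by `p`. -/
def missing : List Bool → List Bool → Bool
  | [], _ => false
  | b :: s, [] => b || missing s []
  | _ :: s, _ :: p => missing s p

/-- The number whose binary digits, the lowest first, are the values under `p` of the variables in
the scope with characteristic vector `s`. Unassigned variables count as `false`. -/
def tableIndex : List Bool → List Bool → ℕ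
  | [], _ => 0
  | false :: s, p => tableIndex s p.tail
  | true :: s, p => (p.headD false).toNat + 2 * tableIndex s p.tail

/-- The whole prefix `p` is moved to `path`. The index is needed only if no variable of the scope
is missing; otherwise the constraint is skipped. -/
theorem runs_scopeLoop (s p : List Bool) (hp : p.length ≤ s.length) (r : Register k)
    (rest a c e : List (Option Bool)) (o : List R) :
    ∃ r' : Register k,
      Runs scopeLoop ⟨r, memory (s.map some ++ none :: rest) a c (p.map some) e, o⟩
        ⟨r', memory rest (s.reverse.map some ++ a) (p.reverse.map some ++ c) [] e, o⟩
        (2 * s.length + 1) ∧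
      r'.cur = some none ∧ r'.ok = r.ok ∧ r'.entry = r.entry ∧
      r'.skip = (r.skip || missing s p) ∧
      (missing s p = false → r'.idx = r.idx + r.wt * (tableIndex s p : ZMod (2 ^ k))) := by
  induction s generalizing p r a c with
  | nil =>
    have : p = [] := by simpa using hp
    subst this
    refine ⟨{ r with cur := some none }, ?_, by simp [missing, tableIndex]⟩
    exact runs_loop_exit (by simp [runOps, Op.run, pop]) rfl
  | cons b s ih =>
    obtain ⟨r', hr, h1, h2, h3, h4, h5⟩ := ih p.tail
      (by simp at hp ⊢; omega)
      (Register.readScope { r with cur := some (some b), val := p.head?.map some })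
      (some b :: a) (p.head?.toList.map some ++ c)
    refine ⟨r', ?_, h1, ?_⟩
    · have hw : (b :: s).reverse.map some ++ a = s.reverse.map some ++ some b :: a := by simp
      have hw' : p.reverse.map some ++ c =
          p.tail.reverse.map some ++ (p.head?.toList.map some ++ c) := by cases p <;> simp
      rw [hw, hw']
      refine (LoopSteps.single (s₁ := ⟨{ r with cur := some (some b) },
        memory (s.map some ++ none :: rest) a c (p.map some) e, o⟩) ?_ rfl (runs_block ?_) _ _
        hr).mono (t := 1 + 1 + (2 * s.length + 1)) (by simp; omega)
      · simp [runOps, Op.run, pop]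
      · cases p <;> simp [runOps, Op.run, pushCur]
    · rcases p with _ | ⟨x, p⟩ <;> rcases b with _ | _ <;>
        simp_all [Register.readScope, missing, tableIndex]
      intro h
      rw [mul_add, ← add_assoc, mul_assoc]

theorem runs_tableLoop (t : List Bool) (r : Register k)
    (rest a c d e : List (Option Bool)) (o : List R) :
    ∃ r' : Register k,
      Runs tableLoop ⟨r, memory (t.map some ++ none :: rest) a c d e, o⟩
        ⟨r', memory rest (t.reverse.map some ++ a) c d e, o⟩ (2 * t.length + 1) ∧
      r'.cur = some none ∧ r'.ok = r.ok ∧ r'.skip = r.skip ∧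
      (∀ b, r.entry = some b → r'.entry = some b) ∧
      (r.entry = none → t.length ≤ 2 ^ k → ∀ N : ℕ, N < t.length → r.idx = N →
        r'.entry = t[N]?) := by
  induction t generalizing r a with
  | nil =>
    refine ⟨{ r with cur := some none }, ?_, by simp⟩
    exact runs_loop_exit (by simp [runOps, Op.run, pop]) rfl
  | cons b t ih =>
    obtain ⟨r', hr, h1, h2, h3, h4, h5⟩ := ih
      (Register.readTable { r with cur := some (some b) }) (some b :: a)
    refine ⟨r', ?_, h1, h2, h3, ?_, ?_⟩
    · have hw : (b :: t).reverse.map some ++ a = t.reverse.map some ++ some b :: a := by simp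
      rw [hw]
      refine (LoopSteps.single (s₁ := ⟨{ r with cur := some (some b) },
        memory (t.map some ++ none :: rest) a c d e, o⟩) ?_ rfl (runs_block ?_) _ _
        hr).mono (t := 1 + 1 + (2 * t.length + 1)) (by simp; omega)
      · simp [runOps, Op.run, pop]
      · simp [runOps, Op.run, pushCur]
    · intro x hx
      exact h4 x (by simp [Register.readTable, hx])
    · intro hn ht N hN hidx
      rcases N with _ | N
      · simpa using h4 b (by simp [Register.readTable, hn, hidx])
      · -- `N + 1 < 2 ^ k`, so the residue of `N + 1` does not vanish.
        have h0 : r.idx ≠ 0 := by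
          rw [hidx, Ne, ZMod.natCast_eq_zero_iff]
          intro hd
          have := Nat.le_of_dvd (by omega) hd
          omega
        have := h5 (by simp [Register.readTable, hn, h0]) (by simp at ht; omega) N
          (by simpa using hN) (by simp [Register.readTable, hidx])
        simpa using this

/-- The register is in the state required at the beginning of a constraint. -/
def Register.Ready (r : Register k) : Prop :=
  r.skip = false ∧ r.entry = none ∧ r.idx = 0 ∧ r.wt = 1

/-- The values `p` of the first variables do not violate the constraint with characteristic vector
`s` and truth table `t`. -/
def respects (p : List Bool) (st : List Bool × List Bool) : Bool :=
  missing st.1 p || st.2[tableIndex st.1 p]? == some true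

theorem runs_constraintProg (s t p : List Bool) (hp : p.length ≤ s.length) (ht : t.length = 2 ^ k)
    (hst : missing s p = false → tableIndex s p < 2 ^ k) (r : Register k) (hr : r.Ready)
    (rest a e : List (Option Bool)) (o : List R) :
    ∃ r' : Register k,
      Runs constraintProg
        ⟨r, memory (encodeBits s ++ encodeBits t ++ rest) a [] (p.map some) e, o⟩
        ⟨r', memory rest ((encodeBits s ++ encodeBits t).reverse ++ a) [] (p.map some) e, o⟩
        (4 * s.length + 2 * t.length + 5) ∧
      r'.Ready ∧ r'.ok = (r.ok && respects p (s, t)) := by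
  obtain ⟨r1, hr1, h1c, h1o, h1e, h1s, h1i⟩ := runs_scopeLoop s p hp r
    (encodeBits t ++ rest) a [] e o
  obtain ⟨r2, hr2, h2c, h2o, h2s, -, h2e⟩ := runs_tableLoop t { r1 with cur := none } rest
    (none :: s.reverse.map some ++ a) [] (p.map some) e o
  refine ⟨r2.conclude, ?_, by simp [Register.conclude, Register.Ready], ?_⟩
  · refine Runs.mono (Runs.seq (s' := ⟨r1, memory (encodeBits t ++ rest) (s.reverse.map some ++ a)
      (p.reverse.map some) [] e, o⟩) ?_ (Runs.seq
        (s' := ⟨r1, memory (encodeBits t ++ rest) (none :: s.reverse.map some ++ a)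
          (p.reverse.map some) [] e, o⟩) ?_
        (Runs.seq
          (s' := ⟨{ r1 with cur := none }, memory (encodeBits t ++ rest)
            (none :: s.reverse.map some ++ a) [] (p.map some) e, o⟩) ?_
          (Runs.seq (s' := ⟨r2, memory rest
            (t.reverse.map some ++ (none :: s.reverse.map some ++ a)) [] (p.map some) e, o⟩) ?_
            ?_))))
      (t := (2 * s.length + 1) + (1 + ((2 * p.length + 1) + ((2 * t.length + 1) + 1))))
      (by omega)
    · simpa [encodeBits] using hr1
    · exact runs_block (by simp [runOps, Op.run, pushCur, h1c])
    · simpa using runs_move_path_front (encodeBits t ++ rest) (none :: s.reverse.map some ++ a)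
        (p.reverse.map some) [] e r1 o
    · simpa [encodeBits] using hr2
    · exact runs_block (by simp [runOps, Op.run, pushCur, h2c, encodeBits])
  · obtain ⟨hs, he, hi, hw⟩ := hr
    have h2 : r2.skip = missing s p := by simpa [h1s, hs] using h2s
    have h3 : r2.ok = r.ok := by simpa [h1o] using h2o
    simp only [Register.conclude, respects, h2, h3]
    cases hm : missing s p
    · rw [h2e (by simpa [h1e] using he) ht.le (tableIndex s p) (ht ▸ hst hm)
        (by simpa [hi, hw] using h1i hm)]
    · rfl

/-- The encoding of a list of constraints, given by characteristic vectors and truth tables. -/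
def encodePairs (L : List (List Bool × List Bool)) : List (Option Bool) :=
  L.flatMap fun st => encodeBits st.1 ++ encodeBits st.2

/-- The words have the lengths of characteristic vectors of subsets of `n` variables and of truth
tables of arity `k`, and the indices computed from the former lie inside the latter. -/
def WellFormed (k n : ℕ) (L : List (List Bool × List Bool)) : Prop :=
  ∀ st ∈ L, st.1.length = n ∧ st.2.length = 2 ^ k ∧
    ∀ p, missing st.1 p = false → tableIndex st.1 p < 2 ^ k

theorem loopSteps_constraintLoop {n : ℕ} (L : List (List Bool × List Bool))
    (hL : WellFormed k n L) (p : List Bool) (hp : p.length ≤ n) (r : Register k) (hr : r.Ready)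
    (a e : List (Option Bool)) (o : List R) :
    ∃ r' : Register k, LoopSteps constraintLoop
        ⟨r, memory (encodePairs L) a [] (p.map some) e, o⟩
        ⟨r', memory [] ((encodePairs L).reverse ++ a) [] (p.map some) e, o⟩
        (L.length * (4 * n + 2 * 2 ^ k + 6)) ∧
      r'.Ready ∧ r'.ok = (r.ok && L.all (respects p)) := by
  induction L generalizing r a with
  | nil => exact ⟨r, by simpa [encodePairs] using LoopSteps.refl _ _, hr, by simp⟩
  | cons st L ih =>
    obtain ⟨s, t⟩ := st
    obtain ⟨hs, ht, hst⟩ := hL _ List.mem_cons_self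
    simp only at hs ht hst
    have hne : ∃ x w, encodePairs ((s, t) :: L) = x :: w := by
      cases s <;> simp [encodePairs, encodeBits]
    obtain ⟨x, w, hx⟩ := hne
    -- The loop condition leaves the first symbol `x` of the constraint in `cur`.
    obtain ⟨r1, hr1, h1, h2⟩ := runs_constraintProg s t p (hs ▸ hp) ht (hst p)
      { r with cur := some x } hr (encodePairs L) a e o
    obtain ⟨r2, hr2, h3, h4⟩ := ih (fun st h => hL st (List.mem_cons_of_mem _ h)) r1 h1
      ((encodeBits s ++ encodeBits t).reverse ++ a)
    refine ⟨r2, ?_, h3, by simp [h4, h2, Bool.and_assoc]⟩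
    have hw : (encodePairs ((s, t) :: L)).reverse ++ a =
        (encodePairs L).reverse ++ ((encodeBits s ++ encodeBits t).reverse ++ a) := by
      simp [encodePairs]
    rw [hw]
    refine ((LoopSteps.single (s₁ := ⟨{ r with cur := some x },
        memory (encodePairs ((s, t) :: L)) a [] (p.map some) e, o⟩) ?_ rfl hr1).trans hr2).mono ?_
    · simp [runOps, Op.run, pop, pushCur, hx]
    · rw [hs, ht, List.length_cons, add_mul]
      omega

theorem runs_check {n : ℕ} (L : List (List Bool × List Bool))
    (hL : WellFormed k n L) (d : List Bool) (hd : d.length ≤ n)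
    (e : List (Option Bool)) (o : List R) :
    ∃ r' : Register k, Runs check
        ⟨Register.down k, memory (encodePairs L) [] (d.map some) [] e, o⟩
        ⟨r', memory (encodePairs L) [] (d.map some) [] e, o⟩
        (L.length * (4 * n + 2 * 2 ^ k + 6) + 2 * (encodePairs L).length + 4 * n + 4) ∧
      r'.ok = L.all (respects d.reverse) := by
  obtain ⟨r1, hr1, h1, h2⟩ := loopSteps_constraintLoop (R := R) L hL d.reverse (by simpa using hd)
    (Register.down k) (by simp [Register.down, Register.Ready]) [] e o
  refine ⟨{ r1 with cur := none }, ?_, by simpa [Register.down] using h2⟩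
  refine Runs.mono (Runs.seq (s' := ⟨Register.down k,
      memory (encodePairs L) [] [] (d.reverse.map some) e, o⟩) ?_
    (Runs.seq (s' := ⟨{ r1 with cur := none },
      memory [] (encodePairs L).reverse [] (d.reverse.map some) e, o⟩) ?_
    (Runs.seq (s' := ⟨{ r1 with cur := none },
      memory (encodePairs L) [] [] (d.reverse.map some) e, o⟩) ?_ ?_)))
    (t := (2 * d.length + 1) + ((L.length * (4 * n + 2 * 2 ^ k + 6) + 1) +
      ((2 * (encodePairs L).length + 1) + (2 * d.length + 1)))) (by omega)
  · simpa [Register.down] using runs_move_path_front (encodePairs L) [] (d.map some) [] e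
      (Register.down k) o
  · exact hr1.exit (by simp [runOps, Op.run, pop, pushCur]) rfl
  · simpa using runs_move_done_input [] (encodePairs L).reverse [] (d.reverse.map some) e
      { r1 with cur := none } o
  · simpa using runs_move_front_path (encodePairs L) [] [] (d.reverse.map some) e
      { r1 with cur := none } o

end CompleteCSP

namespace CompleteCSP

open StackProgram

variable {k : ℕ} {R : Type}

/-! ### The search for satisfying assignments -/

/-- Count the variables and discard the separator after them. The output stack is initialised
with `init`. -/
def setup (init : Option R) : Prog Stack (Option Bool) R (Register k) :=
  .seq (.block [.emit fun _ => init]) <|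
    .seq (.loop [pop .input] Register.isBit (.block [.push .free fun _ => some none]))
      (.block [.load fun _ => Register.down k])

/-- One step of the depth-first search. On the way down the current partial assignment is checked,
and then extended by `false` or, if all variables are assigned, processed by `collect`.
On the way up the last value `false` is replaced by `true`, and the last value `true` is removed. -/
def searchBody (collect : Prog Stack (Option Bool) R (Register k)) :
    Prog Stack (Option Bool) R (Register k) :=
  .ite [] Register.enter
    (.seq check <| .ite [] Register.ok
      (.ite [pop .free] Register.nonempty
        (.block [.push .path fun _ => some (some false), .load fun _ => Register.down k])
        (.seq collect <| .block [.load fun _ => Register.up k]))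
      (.block [.load fun _ => Register.up k]))
    (.ite [pop .path] Register.nonempty
      (.ite [] (fun r => r.cur == some (some true))
        (.block [.push .free fun _ => some none, .load fun _ => Register.up k])
        (.block [.push .path fun _ => some (some true), .load fun _ => Register.down k]))
      (.block [.load fun _ => Register.finished k]))

/-- The depth-first search. -/
def search (collect : Prog Stack (Option Bool) R (Register k)) :
    Prog Stack (Option Bool) R (Register k) :=
  .loop [] Register.run (searchBody collect)

/-- Remove the content of a stack. -/
def clear (i : Stack) : Prog Stack (Option Bool) R (Register k) :=
  .loop [pop i] Register.nonempty (.block [])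

/-- The whole program; `collect` processes the satisfying assignments found. -/
def solver (init : Option R) (collect : Prog Stack (Option Bool) R (Register k)) :
    Prog Stack (Option Bool) R (Register k) :=
  .seq (setup init) <| .seq (search collect) <| .seq (clear .input) <| .seq (clear .free) <|
    .block [.load fun _ => Register.down k]

/-- The effect on the output of searching the extensions of `d` by `j` values, when a satisfying
assignment `d` has the effect `E d`. -/
def visit (good : List Bool → Bool) (E : List Bool → List R → List R) :
    ℕ → List Bool → List R → List R
  | 0, d, o => if good d then E d o else o
  | j + 1, d, o => if good d then visit good E j (true :: d) (visit good E j (false :: d) o) else o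

/-- The number of nodes in the search tree below `d`. -/
def nodes (good : List Bool → Bool) : ℕ → List Bool → ℕ
  | 0, _ => 1
  | j + 1, d => if good d then 1 + nodes good j (false :: d) + nodes good j (true :: d) else 1

variable [Inhabited R]

theorem loopSteps_search {n tc te : ℕ} {B : List (Option Bool)} {good : List Bool → Bool}
    {E : List Bool → List R → List R} {collect : Prog Stack (Option Bool) R (Register k)}
    (hcheck : ∀ (d : List Bool) (e : List (Option Bool)) (o : List R), d.length ≤ n →
      ∃ r' : Register k, Runs check ⟨Register.down k, memory B [] (d.map some) [] e, o⟩
        ⟨r', memory B [] (d.map some) [] e, o⟩ tc ∧ r'.ok = good d)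
    (hcollect : ∀ (d : List Bool) (r : Register k) (o : List R), d.length = n →
      ∃ r' : Register k, Runs collect ⟨r, memory B [] (d.map some) [] [], o⟩
        ⟨r', memory B [] (d.map some) [] [], E d o⟩ te)
    (j : ℕ) (d : List Bool) (hd : d.length + j = n) (o : List R) :
    LoopSteps (search collect)
      ⟨Register.down k, memory B [] (d.map some) [] (List.replicate j none), o⟩
      ⟨Register.up k, memory B [] (d.map some) [] (List.replicate j none), visit good E j d o⟩
      (nodes good j d * (tc + te + 15)) := by
  induction j generalizing d o with
  | zero =>
    obtain ⟨r1, h1, hok⟩ := hcheck d [] o (by omega)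
    cases hg : good d
    · have stay : LoopSteps (search collect)
          ⟨Register.down k, memory B [] (d.map some) [] (List.replicate 0 none), o⟩
          ⟨Register.up k, memory B [] (d.map some) [] (List.replicate 0 none), o⟩
          (1 + (1 + (tc + (1 + 1)))) :=
        LoopSteps.single rfl rfl (Runs.ite_true rfl rfl (h1.seq (Runs.ite_false rfl (hok.trans hg)
          (runs_block rfl))))
      simpa [visit, nodes, hg] using stay.mono (t' := tc + te + 15) (by omega)
    · obtain ⟨r2, h2⟩ := hcollect d { r1 with cur := none } o (by omega)
      have stay : LoopSteps (search collect)
          ⟨Register.down k, memory B [] (d.map some) [] (List.replicate 0 none), o⟩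
          ⟨Register.up k, memory B [] (d.map some) [] (List.replicate 0 none), E d o⟩
          (1 + (1 + (tc + (1 + (1 + (te + 1)))))) :=
        LoopSteps.single rfl rfl (Runs.ite_true rfl rfl (h1.seq (Runs.ite_true rfl (hok.trans hg)
          (Runs.ite_false (s₁ := ⟨{ r1 with cur := none }, memory B [] (d.map some) [] [], o⟩)
            (by simp [runOps, Op.run, pop]) rfl (h2.seq (runs_block rfl))))))
      simpa [visit, nodes, hg] using stay.mono (t' := tc + te + 15) (by omega)
  | succ j ih =>
    obtain ⟨r1, h1, hok⟩ := hcheck d (List.replicate (j + 1) none) o (by omega)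
    cases hg : good d
    · have stay : LoopSteps (search collect)
          ⟨Register.down k, memory B [] (d.map some) [] (List.replicate (j + 1) none), o⟩
          ⟨Register.up k, memory B [] (d.map some) [] (List.replicate (j + 1) none), o⟩
          (1 + (1 + (tc + (1 + 1)))) :=
        LoopSteps.single rfl rfl (Runs.ite_true rfl rfl (h1.seq (Runs.ite_false rfl (hok.trans hg)
          (runs_block rfl))))
      simpa [visit, nodes, hg] using stay.mono (t' := tc + te + 15) (by omega)
    · have down : LoopSteps (search collect)
          ⟨Register.down k, memory B [] (d.map some) [] (List.replicate (j + 1) none), o⟩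
          ⟨Register.down k, memory B [] ((false :: d).map some) [] (List.replicate j none), o⟩
          (1 + (1 + (tc + (1 + (1 + 1))))) :=
        LoopSteps.single rfl rfl (Runs.ite_true rfl rfl (h1.seq (Runs.ite_true rfl (hok.trans hg)
          (Runs.ite_true (s₁ := ⟨{ r1 with cur := some none },
            memory B [] (d.map some) [] (List.replicate j none), o⟩)
            (by simp [runOps, Op.run, pop, List.replicate_succ]) rfl
            (runs_block (by simp [runOps, Op.run]))))))
      have turn (o' : List R) : LoopSteps (search collect)
          ⟨Register.up k, memory B [] ((false :: d).map some) [] (List.replicate j none), o'⟩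
          ⟨Register.down k, memory B [] ((true :: d).map some) [] (List.replicate j none), o'⟩
          (1 + (1 + (1 + (1 + 1)))) :=
        LoopSteps.single rfl rfl (Runs.ite_false rfl rfl (Runs.ite_true
          (s₁ := ⟨{ Register.up k with cur := some (some false) },
            memory B [] (d.map some) [] (List.replicate j none), o'⟩)
          (by simp [runOps, Op.run, pop]) rfl (Runs.ite_false rfl rfl
            (runs_block (by simp [runOps, Op.run])))))
      have up (o' : List R) : LoopSteps (search collect)
          ⟨Register.up k, memory B [] ((true :: d).map some) [] (List.replicate j none), o'⟩
          ⟨Register.up k, memory B [] (d.map some) [] (List.replicate (j + 1) none), o'⟩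
          (1 + (1 + (1 + (1 + 1)))) :=
        LoopSteps.single rfl rfl (Runs.ite_false rfl rfl (Runs.ite_true
          (s₁ := ⟨{ Register.up k with cur := some (some true) },
            memory B [] (d.map some) [] (List.replicate j none), o'⟩)
          (by simp [runOps, Op.run, pop]) rfl (Runs.ite_true rfl rfl
            (runs_block (by simp [runOps, Op.run, List.replicate_succ])))))
      have hf := ih (false :: d) (by simp; omega) o
      have ht := ih (true :: d) (by simp; omega) (visit good E j (false :: d) o)
      simp only [visit, nodes, hg, if_true]
      refine ((((down.trans hf).trans (turn _)).trans ht).trans (up _)).mono ?_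
      rw [add_mul, add_mul]
      omega

theorem runs_clear_input (a b c d e : List (Option Bool)) (r : Register k) (o : List R) :
    Runs (clear .input) ⟨r, memory a b c d e, o⟩
      ⟨{ r with cur := none }, memory [] b c d e, o⟩ (2 * a.length + 1) := by
  induction a generalizing r with
  | nil => exact runs_loop_exit (by simp [runOps, Op.run, pop]) rfl
  | cons x a ih =>
    have step : LoopSteps (clear .input) ⟨r, memory (x :: a) b c d e, o⟩
        ⟨{ r with cur := some x }, memory a b c d e, o⟩ (1 + 1) :=
      LoopSteps.single (by simp [runOps, Op.run, pop]) rfl (runs_block rfl)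
    exact (step _ _ (ih { r with cur := some x })).mono (by simp; omega)

theorem runs_clear_free (a b c d e : List (Option Bool)) (r : Register k) (o : List R) :
    Runs (clear .free) ⟨r, memory a b c d e, o⟩
      ⟨{ r with cur := none }, memory a b c d [], o⟩ (2 * e.length + 1) := by
  induction e generalizing r with
  | nil => exact runs_loop_exit (by simp [runOps, Op.run, pop]) rfl
  | cons x e ih =>
    have step : LoopSteps (clear .free) ⟨r, memory a b c d (x :: e), o⟩
        ⟨{ r with cur := some x }, memory a b c d e, o⟩ (1 + 1) :=
      LoopSteps.single (by simp [runOps, Op.run, pop]) rfl (runs_block rfl)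
    exact (step _ _ (ih { r with cur := some x })).mono (by simp; omega)

theorem runs_setup (init : Option R) (n : ℕ) (B : List (Option Bool)) :
    Runs (setup init)
      ⟨Register.down k, memory (encodeBits (List.replicate n true) ++ B) [] [] [] [], []⟩
      ⟨Register.down k, memory B [] [] [] (List.replicate n none), init.toList⟩
      (2 * n + 3) := by
  have count (n : ℕ) (r : Register k) (e : List (Option Bool)) (o : List R) :
      Runs (.loop [pop .input] Register.isBit (.block [.push .free fun _ => some none]))
        ⟨r, memory (encodeBits (List.replicate n true) ++ B) [] [] [] e, o⟩
        ⟨{ r with cur := some none }, memory B [] [] [] (List.replicate n none ++ e), o⟩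
        (2 * n + 1) := by
    induction n generalizing r e with
    | zero => exact runs_loop_exit (by simp [runOps, Op.run, pop, encodeBits]) rfl
    | succ n ih =>
      have hw : List.replicate (n + 1) none ++ e =
          (List.replicate n none ++ none :: e : List (Option Bool)) := by
        simp [List.replicate_succ']
      rw [hw]
      refine (LoopSteps.single (s₁ := ⟨{ r with cur := some (some true) },
        memory (encodeBits (List.replicate n true) ++ B) [] [] [] e, o⟩)
        (by simp [runOps, Op.run, pop, encodeBits, List.replicate_succ]) rfl
        (runs_block (by simp [runOps, Op.run])) _ _
        (ih { r with cur := some (some true) } (none :: e))).mono (by omega)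
  have h := count n (Register.down k) [] init.toList
  rw [List.append_nil] at h
  exact (Runs.seq (runs_block (by simp [runOps, Op.run])) (h.seq (runs_block rfl))).mono
    (by omega)

theorem runs_solver {n tc te : ℕ} {B : List (Option Bool)} {good : List Bool → Bool}
    {E : List Bool → List R → List R} {collect : Prog Stack (Option Bool) R (Register k)}
    (hcheck : ∀ (d : List Bool) (e : List (Option Bool)) (o : List R), d.length ≤ n →
      ∃ r' : Register k, Runs check ⟨Register.down k, memory B [] (d.map some) [] e, o⟩
        ⟨r', memory B [] (d.map some) [] e, o⟩ tc ∧ r'.ok = good d)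
    (hcollect : ∀ (d : List Bool) (r : Register k) (o : List R), d.length = n →
      ∃ r' : Register k, Runs collect ⟨r, memory B [] (d.map some) [] [], o⟩
        ⟨r', memory B [] (d.map some) [] [], E d o⟩ te)
    (init : Option R) :
    Runs (solver init collect)
      ⟨Register.down k, memory (encodeBits (List.replicate n true) ++ B) [] [] [] [], []⟩
      ⟨Register.down k, memory [] [] [] [] [], visit good E n [] init.toList⟩
      (nodes good n [] * (tc + te + 15) + 4 * n + 2 * B.length + 11) := by
  have h1 := loopSteps_search hcheck hcollect n [] (by simp) init.toList
  have h2 : LoopSteps (search collect)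
      ⟨Register.up k, memory B [] [] [] (List.replicate n none), visit good E n [] init.toList⟩
      ⟨Register.finished k, memory B [] [] [] (List.replicate n none),
        visit good E n [] init.toList⟩ (1 + (1 + (1 + 1))) :=
    LoopSteps.single rfl rfl (Runs.ite_false rfl rfl (Runs.ite_false
      (s₁ := ⟨Register.up k, memory B [] [] [] (List.replicate n none),
        visit good E n [] init.toList⟩)
      (by simp [runOps, Op.run, pop, Register.up, Register.down]) rfl (runs_block rfl)))
  have h3 := (h1.trans h2).exit (l := []) (c := Register.run) rfl rfl
  exact ((runs_setup init n B).seq (h3.seq ((runs_clear_input _ _ _ _ _ _ _).seq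
    ((runs_clear_free _ _ _ _ _ _ _).seq (runs_block rfl))))).mono (by simp; omega)

/-! ### The machine of a program -/

/-- The Turing machine that executes a program. -/
noncomputable def machine (p : Prog Stack (Option Bool) R (Register k)) :
    Turing.TM2ComputableAux (Option Bool) R where
  tm :=
    { K := Option Stack
      k₀ := some .input
      k₁ := none
      Γ := Alphabet Stack (Option Bool) R
      Λ := p.Label
      main := p.start
      σ := Register k
      initialState := Register.down k
      Γk₀Fin := inferInstanceAs (Fintype (Option Bool))
      m := p.code id none }
  inputAlphabet := Equiv.refl (Option Bool)
  outputAlphabet := Equiv.refl R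

theorem outputsWithin_machine {p : Prog Stack (Option Bool) R (Register k)}
    {x : List (Option Bool)} {y : List R} {t : ℕ}
    (h : Runs p ⟨Register.down k, memory x [] [] [] [], []⟩
      ⟨Register.down k, memory [] [] [] [] [], y⟩ t) :
    OutputsWithin (machine p) x y t := by
  obtain ⟨u, hu, hr⟩ := h p.Label (p.code id none) id none fun _ => rfl
  refine ⟨⟨⟨u, ?_⟩, hu⟩⟩
  have hx : Turing.initList (machine p).tm (x.map (machine p).inputAlphabet.invFun) =
      ⟨some p.start, Register.down k,
        State.stacks ⟨Register.down k, memory x [] [] [] [], ([] : List R)⟩⟩ := by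
    have : x.map (machine p).inputAlphabet.invFun = x := List.map_id x
    rw [this]
    unfold Turing.initList
    congr 1
    funext i
    rcases i with _ | _ | _ | _ | _ | _ <;> rfl
  have hy : Turing.haltList (machine p).tm (y.map (machine p).outputAlphabet.invFun) =
      ⟨none, Register.down k, State.stacks ⟨Register.down k, memory [] [] [] [] [], y⟩⟩ := by
    have : y.map (machine p).outputAlphabet.invFun = y := List.map_id y
    rw [this]
    unfold Turing.haltList
    congr 1
    funext i
    rcases i with _ | _ | _ | _ | _ | _ <;> rfl
  rw [hx, Option.map_some, hy]
  exact hr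

end CompleteCSP

namespace CompleteCSP

open StackProgram

/-! ### The search tree -/

/-- The satisfying assignments found by the search below `d`, in the order of the output. -/
def leaves (good : List Bool → Bool) : ℕ → List Bool → List (List Bool)
  | 0, d => if good d then [d] else []
  | j + 1, d => if good d then leaves good j (true :: d) ++ leaves good j (false :: d) else []

theorem visit_append {R : Type} (good : List Bool → Bool) (f : List Bool → List R) (j : ℕ)
    (d : List Bool) (o : List R) :
    visit good (fun d o => f d ++ o) j d o = (leaves good j d).flatMap f ++ o := by
  induction j generalizing d o with
  | zero => cases h : good d <;> simp [visit, leaves, h]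
  | succ j ih => cases h : good d <;> simp [visit, leaves, h, ih]

theorem visit_accept (good : List Bool → Bool) (j : ℕ) (d : List Bool) (b : Bool) :
    visit good (fun _ o => true :: o.tail) j d [b] = [b || !(leaves good j d).isEmpty] := by
  induction j generalizing d b with
  | zero => cases h : good d <;> simp [visit, leaves, h]
  | succ j ih =>
    cases h : good d
    · simp [visit, leaves, h]
    · simp only [visit, leaves, h, ih, if_true, Bool.or_assoc]
      cases leaves good j (true :: d) <;> cases leaves good j (false :: d) <;> simp

theorem mem_leaves {good : List Bool → Bool} (hgood : ∀ b d, good (b :: d) → good d) {j : ℕ}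
    {d x : List Bool} : x ∈ leaves good j d ↔ good x ∧ ∃ e, e.length = j ∧ x = e ++ d := by
  have suffix (e d : List Bool) : good (e ++ d) → good d := by
    induction e with
    | nil => exact id
    | cons b e ih => exact fun h => ih (hgood b _ h)
  induction j generalizing d with
  | zero =>
    cases h : good d
    · simp only [leaves, h, Bool.false_eq_true, if_false, List.not_mem_nil, false_iff]
      rintro ⟨hx, e, he, rfl⟩
      exact absurd (suffix e d hx) (by simp [h])
    · simp +contextual [leaves, h]
  | succ j ih =>
    have hx : (∃ e : List Bool, e.length = j + 1 ∧ x = e ++ d) ↔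
        (∃ e : List Bool, e.length = j ∧ x = e ++ true :: d) ∨
          ∃ e : List Bool, e.length = j ∧ x = e ++ false :: d := by
      constructor
      · rintro ⟨e, he, rfl⟩
        obtain ⟨e', b, rfl⟩ := List.eq_nil_or_concat e |>.resolve_left (by rintro rfl; simp at he)
        cases b
        · exact .inr ⟨e', by simpa using he, by simp⟩
        · exact .inl ⟨e', by simpa using he, by simp⟩
      · rintro (⟨e, he, rfl⟩ | ⟨e, he, rfl⟩)
        · exact ⟨e ++ [true], by simp [he], by simp⟩
        · exact ⟨e ++ [false], by simp [he], by simp⟩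
    cases h : good d
    · simp only [leaves, h, Bool.false_eq_true, if_false, List.not_mem_nil, false_iff, not_and,
        not_exists]
      rintro hg e - rfl
      exact absurd (suffix e d hg) (by simp [h])
    · simp only [leaves, h, if_true, List.mem_append, ih, hx, and_or_left]

theorem nodup_leaves {good : List Bool → Bool} (hgood : ∀ b d, good (b :: d) → good d) (j : ℕ)
    (d : List Bool) : (leaves good j d).Nodup := by
  induction j generalizing d with
  | zero => cases h : good d <;> simp [leaves, h]
  | succ j ih =>
    cases h : good d
    · simp [leaves, h]
    · simp only [leaves, h, if_true]
      refine (ih _).append (ih _) fun x hx hx' => ?_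
      obtain ⟨-, e, he, rfl⟩ := (mem_leaves hgood).1 hx
      obtain ⟨-, e', he', h'⟩ := (mem_leaves hgood).1 hx'
      have := (List.append_inj h' (he.trans he'.symm)).2
      simp at this

/-- Every node of the search tree except its root is a child of a good node. -/
theorem nodes_le (good : List Bool → Bool) (j : ℕ) (d : List Bool) :
    nodes good j d ≤ 1 + 2 * ∑ i ∈ Finset.range j, (leaves good i d).length := by
  induction j generalizing d with
  | zero => simp [nodes]
  | succ j ih =>
    cases h : good d
    · simp [nodes, h]
    · have hf := ih (false :: d)
      have ht := ih (true :: d)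
      rw [Finset.sum_range_succ']
      simp only [nodes, leaves, h, if_true, List.length_append, Finset.sum_add_distrib,
        List.length_singleton]
      omega

/-! ### Scopes and truth tables as words -/

theorem missing_eq_false_iff {s p : List Bool} :
    missing s p = false ↔ ∀ j, s[j]? = some true → j < p.length := by
  induction s generalizing p with
  | nil => simp [missing]
  | cons b s ih =>
    rcases p with _ | ⟨x, p⟩
    · simp only [missing, Bool.or_eq_false_iff, ih]
      constructor
      · rintro ⟨rfl, h⟩ (_ | j) hj
        · simp at hj
        · exact absurd (h j (by simpa using hj)) (by simp)
      · intro h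
        refine ⟨?_, fun j hj => absurd (h (j + 1) (by simpa using hj)) (by simp)⟩
        cases b
        · rfl
        · exact absurd (h 0 (by simp)) (by simp)
    · simp only [missing, ih]
      constructor
      · rintro h (_ | j) hj
        · simp
        · simpa using h j (by simpa using hj)
      · intro h j hj
        simpa using h (j + 1) (by simpa using hj)

theorem tableIndex_lt_two_pow_count (s p : List Bool) : tableIndex s p < 2 ^ s.count true := by
  induction s generalizing p with
  | nil => simp [tableIndex]
  | cons b s ih =>
    have := ih p.tail
    cases b
    · simpa [tableIndex] using this
    · have hb := Bool.toNat_lt (p.headD false)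
      simp only [tableIndex, List.count_cons_self, pow_succ]
      omega

theorem testBit_tableIndex (s p : List Bool) (j : ℕ) (hj : s[j]? = some true) :
    (tableIndex s p).testBit ((s.take j).count true) = p.getD j false := by
  induction s generalizing p j with
  | nil => simp at hj
  | cons b s ih =>
    rcases j with _ | j
    · obtain rfl : b = true := by simpa using hj
      rcases p with _ | ⟨_ | _, p⟩ <;> simp [tableIndex, Nat.testBit_zero]
    · have := ih p.tail j (by simpa using hj)
      have hp : p.tail.getD j false = p.getD (j + 1) false := by cases p <;> simp
      rw [← hp, ← this]
      cases b
      · simp [tableIndex]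
      · have hb := Bool.toNat_lt (p.headD false)
        rw [List.take_succ_cons, List.count_cons_self, Nat.testBit_succ, tableIndex]
        congr 1
        omega

namespace Constraint

variable {n k : ℕ} (C : Constraint n k)

theorem getElem?_scopeBits (j : ℕ) :
    C.scopeBits[j]? = some true ↔ ∃ h : j < n, (⟨j, h⟩ : Fin n) ∈ C.scope := by
  unfold scopeBits
  rw [List.getElem?_ofFn]
  split_ifs with h <;> simp [h]

theorem count_take_scopeBits (j : ℕ) (hj : j ≤ n) :
    (C.scopeBits.take j).count true = (C.scope.filter fun v : Fin n => (v : ℕ) < j).card := by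
  induction j with
  | zero => simp
  | succ j ih =>
    have hjn : j < n := hj
    have hbit : C.scopeBits[j]? = some (decide ((⟨j, hjn⟩ : Fin n) ∈ C.scope)) := by
      unfold scopeBits
      simp [hjn]
    rw [List.take_add_one, List.count_append, ih hjn.le, hbit]
    by_cases hv : (⟨j, hjn⟩ : Fin n) ∈ C.scope
    · have : (C.scope.filter fun v : Fin n => (v : ℕ) < j + 1) =
          insert ⟨j, hjn⟩ (C.scope.filter fun v : Fin n => (v : ℕ) < j) := by
        ext v
        simp only [Finset.mem_filter, Finset.mem_insert, Fin.ext_iff]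
        constructor
        · rintro ⟨h1, h2⟩
          by_cases h : (v : ℕ) = j
          · exact .inl h
          · exact .inr ⟨h1, by omega⟩
        · rintro (h | ⟨h1, h2⟩)
          · exact ⟨by rwa [show v = ⟨j, hjn⟩ from Fin.ext h], by omega⟩
          · exact ⟨h1, by omega⟩
      rw [this, Finset.card_insert_of_notMem (by simp)]
      simp [hv]
    · have : (C.scope.filter fun v : Fin n => (v : ℕ) < j + 1) =
          C.scope.filter fun v : Fin n => (v : ℕ) < j := by
        ext v
        simp only [Finset.mem_filter, and_congr_right_iff]
        intro h1
        have : (v : ℕ) ≠ j := fun h => hv (by rwa [show v = ⟨j, hjn⟩ from Fin.ext h] at h1)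
        omega
      rw [this]
      simp [hv]

theorem length_scopeBits : C.scopeBits.length = n := by simp [scopeBits]

theorem length_table : C.table.length = 2 ^ k := by simp [table]

theorem count_scopeBits : C.scopeBits.count true = k := by
  have := C.count_take_scopeBits n le_rfl
  rw [List.take_of_length_le C.length_scopeBits.le] at this
  rw [this]
  refine Eq.trans (congrArg _ ?_) C.card_scope
  ext v
  simp

theorem tableIndex_lt (p : List Bool) : tableIndex C.scopeBits p < 2 ^ k := by
  have := tableIndex_lt_two_pow_count C.scopeBits p
  rwa [C.count_scopeBits] at this

/-- Assigned values suffice to violate a constraint only if they cover its scope. -/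
theorem respects_iff (p : List Bool) : respects p (C.scopeBits, C.table) = true ↔
    ((∀ v ∈ C.scope, (v : ℕ) < p.length) → C.pred (fun v => p.getD (v : Fin n) false) = true) := by
  have hlt := C.tableIndex_lt p
  have hmissing : missing C.scopeBits p = false ↔ ∀ v ∈ C.scope, (v : ℕ) < p.length := by
    rw [missing_eq_false_iff]
    simp only [C.getElem?_scopeBits]
    exact ⟨fun h v hv => h v ⟨v.2, hv⟩, fun h j ⟨hj, hv⟩ => h _ hv⟩
  have hentry : C.table[tableIndex C.scopeBits p]? =
      some (C.pred fun v => p.getD (v : Fin n) false) := by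
    unfold table
    rw [List.getElem?_ofFn, dif_pos hlt]
    congr 2
    funext v
    rw [← testBit_tableIndex C.scopeBits p (v : Fin n)
      ((C.getElem?_scopeBits _).2 ⟨v.1.2, v.2⟩), C.count_take_scopeBits _ v.1.2.le]
    rfl
  rw [← hmissing]
  simp only [respects, hentry]
  cases missing C.scopeBits p <;> simp

end Constraint

namespace Instance

variable {k : ℕ} (I : Instance k)

/-- The constraints as pairs of words. -/
def pairs : List (List Bool × List Bool) :=
  I.constraints.map fun C => (C.scopeBits, C.table)

theorem encode_eq :
    I.encode = encodeBits (List.replicate I.n true) ++ encodePairs I.pairs := by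
  simp [encode, encodePairs, pairs, List.flatMap_map]

theorem wellFormed_pairs : WellFormed k I.n I.pairs := by
  intro st hst
  obtain ⟨C, -, rfl⟩ := List.mem_map.1 hst
  exact ⟨C.length_scopeBits, C.length_table, fun p _ => C.tableIndex_lt p⟩

/-- The partial assignment that gives the first variables the values in `d`, the latest one first,
violates no constraint. -/
def good (d : List Bool) : Bool := I.pairs.all (respects d.reverse)

theorem good_iff (d : List Bool) : I.good d = true ↔ ∀ C ∈ I.constraints,
    (∀ v ∈ C.scope, (v : ℕ) < d.length) →
      C.pred (fun v => d.reverse.getD (v : Fin I.n) false) = true := by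
  simp only [good, pairs, List.all_map, List.all_eq_true, Function.comp_apply,
    Constraint.respects_iff, List.length_reverse]

theorem good_of_cons (b : Bool) (d : List Bool) (h : I.good (b :: d) = true) :
    I.good d = true := by
  rw [good_iff] at *
  intro C hC hv
  rw [← h C hC fun v hvC => (hv v hvC).trans (by simp)]
  congr 1
  funext v
  have := hv v v.2
  simp [List.getElem?_append_left, this]

/-- The assignment with the values in `d`, the latest variable first. -/
def assignment (d : List Bool) : Fin I.n → Bool := fun v => d.reverse.getD v false

theorem good_iff_satisfies {d : List Bool} (hd : d.length = I.n) :
    I.good d = true ↔ I.Satisfies (I.assignment d) := by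
  rw [good_iff]
  refine forall₂_congr fun C _ => ?_
  exact forall_prop_of_true fun v _ => v.2.trans_eq hd.symm

theorem ofFn_assignment {d : List Bool} (hd : d.length = I.n) :
    List.ofFn (I.assignment d) = d.reverse := by
  refine List.ext_getElem (by simp [hd]) fun i h1 h2 => ?_
  simp only [List.getElem_ofFn, assignment]
  rw [List.getD_eq_getElem _ _ h2]

/-- The satisfying assignments in the order of the output. -/
def solutions : List (Fin I.n → Bool) :=
  (leaves I.good I.n []).map I.assignment

theorem mem_leaves_iff {j : ℕ} {d : List Bool} :
    d ∈ leaves I.good j [] ↔ I.good d = true ∧ d.length = j := by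
  rw [mem_leaves I.good_of_cons]
  simp

theorem mem_solutions (α : Fin I.n → Bool) : α ∈ I.solutions ↔ I.Satisfies α := by
  simp only [solutions, List.mem_map, mem_leaves_iff]
  constructor
  · rintro ⟨d, ⟨h1, h2⟩, rfl⟩
    exact (I.good_iff_satisfies h2).1 h1
  · intro h
    have hα : I.assignment (List.ofFn α).reverse = α := by
      funext v
      simp [assignment]
    exact ⟨(List.ofFn α).reverse, ⟨(I.good_iff_satisfies (by simp)).2 (hα.symm ▸ h), by simp⟩, hα⟩

theorem nodup_solutions : I.solutions.Nodup := by
  refine List.Nodup.map_on ?_ (nodup_leaves I.good_of_cons _ _)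
  intro d hd d' hd' h
  have h1 := I.ofFn_assignment (I.mem_leaves_iff.1 hd).2
  have h2 := I.ofFn_assignment (I.mem_leaves_iff.1 hd').2
  rw [← List.reverse_inj, ← h1, ← h2, h]

/-! ### The number of partial assignments that violate no constraint -/

/-- The set of variables that get the value `true`. -/
def trueSet (d : List Bool) : Finset (Fin I.n) :=
  Finset.univ.filter fun v => d.reverse.getD v false = true

theorem trueSet_injOn {i : ℕ} (hi : i ≤ I.n) {d d' : List Bool} (hd : d.length = i)
    (hd' : d'.length = i) (h : I.trueSet d = I.trueSet d') : d = d' := by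
  rw [← List.reverse_inj]
  refine List.ext_getElem (by simp [hd, hd']) fun j h1 h2 => ?_
  have hj : j < I.n := by simp at h1; omega
  have := congrArg ((⟨j, hj⟩ : Fin I.n) ∈ ·) h
  simp only [trueSet, Finset.mem_filter, Finset.mem_univ, true_and, eq_iff_iff] at this
  rw [List.getD_eq_getElem _ _ h1, List.getD_eq_getElem _ _ h2] at this
  exact Bool.eq_iff_iff.2 this

variable {I}

/-- In a complete instance, no set of more than `k` variables is shattered: a `k`-subset carries a
constraint, and no partial assignment in the family has the restriction which it rejects. -/
theorem card_le_of_shatters (hI : I.Complete) {i : ℕ} {S : Finset (Fin I.n)}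
    (hS : ((leaves I.good i []).map I.trueSet).toFinset.Shatters S) : S.card ≤ k := by
  by_contra! hk
  obtain ⟨T, hTS, hT⟩ := Finset.exists_subset_card_eq hk.le
  have hsh := hS.mono_right hTS
  obtain ⟨C, ⟨hC, rfl⟩, -⟩ := hI.1 T hT
  obtain ⟨σ, hσ⟩ := hI.2 C hC
  have lift {t : Finset (Fin I.n)} (ht : t ⊆ C.scope) :
      ∃ d, (I.good d = true ∧ d.length = i) ∧ C.scope ∩ I.trueSet d = t := by
    obtain ⟨u, hu, hut⟩ := hsh ht
    simp only [List.mem_toFinset, List.mem_map, mem_leaves_iff] at hu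
    obtain ⟨d, hd, rfl⟩ := hu
    exact ⟨d, hd, hut⟩
  -- Some member of the family contains the whole scope, so all its variables are assigned.
  have hlt : ∀ v ∈ C.scope, (v : ℕ) < i := by
    obtain ⟨d, ⟨-, hd⟩, h⟩ := lift subset_rfl
    intro v hv
    rw [← h] at hv
    have hv' := (Finset.mem_filter.1 (Finset.mem_inter.1 hv).2).2
    by_contra! hle
    rw [List.getD_eq_default _ _ (by simpa [hd] using hle)] at hv'
    exact absurd hv' (by simp)
  obtain ⟨d, ⟨hg, hd⟩, h⟩ := lift (t := C.scope.filter fun v => ∃ h : v ∈ C.scope, σ ⟨v, h⟩ = true)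
    (Finset.filter_subset _ _)
  have hpred := (I.good_iff d).1 hg C hC fun v hv => hd.symm ▸ hlt v hv
  have hd' : (fun v : C.scope => d.reverse.getD (v : Fin I.n) false) = σ := by
    funext v
    have := congrArg ((v : Fin I.n) ∈ ·) h
    simp only [trueSet, Finset.mem_inter, Finset.mem_filter, Finset.mem_univ, true_and, v.2,
      exists_true_left, eq_iff_iff] at this
    exact Bool.eq_iff_iff.2 this
  rw [hd', hσ] at hpred
  exact absurd hpred (by simp)

theorem length_leaves_le (hI : I.Complete) {i : ℕ} (hi : i ≤ I.n) :
    (leaves I.good i []).length ≤ (k + 1) * (I.n + 1) ^ k := by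
  set F := ((leaves I.good i []).map I.trueSet).toFinset with hF
  have hcard : F.card = (leaves I.good i []).length := by
    rw [hF, List.toFinset_card_of_nodup, List.length_map]
    refine List.Nodup.map_on ?_ (nodup_leaves I.good_of_cons _ _)
    intro d hd d' hd' h
    exact I.trueSet_injOn hi (I.mem_leaves_iff.1 hd).2 (I.mem_leaves_iff.1 hd').2 h
  have hdim : F.vcDim ≤ k :=
    Finset.sup_le fun S hS => card_le_of_shatters hI (Finset.mem_shatterer.1 hS)
  calc (leaves I.good i []).length = F.card := hcard.symm
    _ ≤ F.shatterer.card := Finset.card_le_card_shatterer F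
    _ ≤ ∑ j ∈ Finset.Iic F.vcDim, (Fintype.card (Fin I.n)).choose j :=
      Finset.card_shatterer_le_sum_vcDim
    _ ≤ ∑ j ∈ Finset.Iic k, (Fintype.card (Fin I.n)).choose j :=
      Finset.sum_le_sum_of_subset (Finset.Iic_subset_Iic.2 hdim)
    _ ≤ ∑ _j ∈ Finset.Iic k, (I.n + 1) ^ k := by
      refine Finset.sum_le_sum fun j hj => ?_
      rw [Fintype.card_fin]
      calc I.n.choose j ≤ I.n ^ j := Nat.choose_le_pow _ _
        _ ≤ (I.n + 1) ^ j := Nat.pow_le_pow_left (Nat.le_succ _) _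
        _ ≤ (I.n + 1) ^ k := Nat.pow_le_pow_right (Nat.succ_pos _) (Finset.mem_Iic.1 hj)
    _ = (k + 1) * (I.n + 1) ^ k := by simp

theorem nodes_good_le (hI : I.Complete) :
    nodes I.good I.n [] ≤ 1 + 2 * (I.n * ((k + 1) * (I.n + 1) ^ k)) := by
  refine (nodes_le _ _ _).trans ?_
  gcongr
  calc ∑ i ∈ Finset.range I.n, (leaves I.good i []).length
      ≤ ∑ _i ∈ Finset.range I.n, (k + 1) * (I.n + 1) ^ k :=
        Finset.sum_le_sum fun i hi => length_leaves_le hI (Finset.mem_range.1 hi).le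
    _ = I.n * ((k + 1) * (I.n + 1) ^ k) := by simp

variable (I)

theorem length_constraints_le : I.constraints.length ≤ I.n ^ k := by
  rw [← List.length_map (f := Constraint.scope), ← List.toFinset_card_of_nodup I.nodup_scopes]
  refine (Finset.card_le_card (t := Finset.powersetCard k Finset.univ) fun S hS => ?_).trans ?_
  · obtain ⟨C, -, rfl⟩ := List.mem_map.1 (List.mem_toFinset.1 hS)
    exact Finset.mem_powersetCard.2 ⟨Finset.subset_univ _, C.card_scope⟩
  · rw [Finset.card_powersetCard, Finset.card_fin]
    exact Nat.choose_le_pow _ _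

theorem length_encodePairs_le :
    (encodePairs I.pairs).length ≤ I.n ^ k * (I.n + 2 ^ k + 2) := by
  have : (encodePairs I.pairs).length = I.constraints.length * (I.n + 2 ^ k + 2) := by
    simp only [encodePairs, pairs, List.flatMap_map, List.length_flatMap, List.length_append,
      encodeBits, List.length_map, List.length_singleton, Constraint.length_scopeBits,
      Constraint.length_table, List.map_const', List.sum_replicate, smul_eq_mul]
    ring
  rw [this]
  exact Nat.mul_le_mul_right _ I.length_constraints_le

end Instance

end CompleteCSP

namespace CompleteCSP

open StackProgram

/-! ### Polynomial bounds -/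

/-- `T n` is bounded by a power of `n` for `2 ≤ n`. -/
def PolyBounded (T : ℕ → ℕ) : Prop :=
  ∃ e : ℕ, ∀ n : ℕ, 2 ≤ n → T n ≤ n ^ e

namespace PolyBounded

variable {S T : ℕ → ℕ}

theorem const (a : ℕ) : PolyBounded fun _ => a :=
  ⟨a, fun _ hn => Nat.lt_two_pow_self.le.trans (Nat.pow_le_pow_left hn a)⟩

theorem id : PolyBounded fun n => n :=
  ⟨1, fun n _ => (pow_one n).ge⟩

theorem mul (hS : PolyBounded S) (hT : PolyBounded T) : PolyBounded fun n => S n * T n := by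
  obtain ⟨a, ha⟩ := hS
  obtain ⟨b, hb⟩ := hT
  exact ⟨a + b, fun n hn => pow_add n a b ▸ Nat.mul_le_mul (ha n hn) (hb n hn)⟩

theorem pow (hS : PolyBounded S) (b : ℕ) : PolyBounded fun n => S n ^ b := by
  obtain ⟨a, ha⟩ := hS
  exact ⟨a * b, fun n hn => pow_mul n a b ▸ Nat.pow_le_pow_left (ha n hn) b⟩

theorem add (hS : PolyBounded S) (hT : PolyBounded T) : PolyBounded fun n => S n + T n := by
  obtain ⟨a, ha⟩ := hS
  obtain ⟨b, hb⟩ := hT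
  -- The additional factor `n` absorbs the factor `2` of `n ^ m + n ^ m`.
  refine ⟨max a b + 1, fun n hn => ?_⟩
  have h1 : n ^ a ≤ n ^ max a b := Nat.pow_le_pow_right (by omega) (le_max_left a b)
  have h2 : n ^ b ≤ n ^ max a b := Nat.pow_le_pow_right (by omega) (le_max_right a b)
  calc S n + T n ≤ n ^ max a b * 2 := by have := ha n hn; have := hb n hn; omega
    _ ≤ n ^ (max a b + 1) := pow_succ n _ ▸ Nat.mul_le_mul_left _ hn

theorem isPowBigOLog (hT : PolyBounded T) : IsPowBigOLog T := by
  obtain ⟨e, he⟩ := hT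
  -- `n ^ e = n ^ (e / log 2 * log 2)`, and `log 2 ≤ log n`.
  refine ⟨e / Real.log 2, fun n hn => ?_⟩
  have hn' : (2 : ℝ) ≤ n := by exact_mod_cast hn
  have hlog : 0 < Real.log 2 := Real.log_pos one_lt_two
  calc (T n : ℝ) ≤ (n : ℝ) ^ (e : ℝ) := by
        rw [Real.rpow_natCast]
        exact_mod_cast he n hn
    _ ≤ (n : ℝ) ^ (e / Real.log 2 * Real.log n) := by
      refine Real.rpow_le_rpow_of_exponent_le (by linarith) ?_
      rw [div_mul_eq_mul_div, le_div_iff₀ hlog]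
      exact mul_le_mul_of_nonneg_left (Real.log_le_log two_pos hn') (Nat.cast_nonneg e)

end PolyBounded

/-- A bound on the number of steps to check a partial assignment. -/
def checkTime (k n : ℕ) : ℕ :=
  n ^ k * (4 * n + 2 * 2 ^ k + 6) + 2 * (n ^ k * (n + 2 ^ k + 2)) + 4 * n + 4

/-- A bound on the running time: the first factor bounds the number of nodes of the search tree,
and `4 * n + 4` the time to process a satisfying assignment. -/
def solverTime (k n : ℕ) : ℕ :=
  (1 + 2 * (n * ((k + 1) * (n + 1) ^ k))) * (checkTime k n + (4 * n + 4) + 15) + 4 * n +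
    2 * (n ^ k * (n + 2 ^ k + 2)) + 11

theorem isPowBigOLog_solverTime (k : ℕ) : IsPowBigOLog (solverTime k) := by
  refine PolyBounded.isPowBigOLog ?_
  have c := PolyBounded.const
  have x := PolyBounded.id
  have hk := x.pow k
  have hB := (c 2).mul (hk.mul ((x.add (c (2 ^ k))).add (c 2)))
  have hc : PolyBounded (checkTime k) :=
    (((hk.mul ((((c 4).mul x).add (c (2 * 2 ^ k))).add (c 6))).add hB).add
      ((c 4).mul x)).add (c 4)
  exact (((((c 1).add ((c 2).mul (x.mul ((c (k + 1)).mul ((x.add (c 1)).pow k))))).mul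
    ((hc.add (((c 4).mul x).add (c 4))).add (c 15))).add ((c 4).mul x)).add hB).add (c 11)

/-! ### The two machines -/

variable {k : ℕ}

theorem runs_solver_of_complete {R : Type} [Inhabited R] {I : Instance k} (hI : I.Complete)
    {E : List Bool → List R → List R} {collect : Prog Stack (Option Bool) R (Register k)}
    (hcollect : ∀ (B : List (Option Bool)) (d : List Bool) (r : Register k) (o : List R),
      d.length = I.n → ∃ r' : Register k, Runs collect ⟨r, memory B [] (d.map some) [] [], o⟩
        ⟨r', memory B [] (d.map some) [] [], E d o⟩ (4 * I.n + 4))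
    (init : Option R) :
    OutputsWithin (machine (solver init collect)) I.encode
      (visit I.good E I.n [] init.toList) (solverTime k I.n) := by
  have hlen : I.pairs.length = I.constraints.length := List.length_map _
  have hcheck : ∀ (d : List Bool) (e : List (Option Bool)) (o : List R), d.length ≤ I.n →
      ∃ r' : Register k,
        Runs check ⟨Register.down k, memory (encodePairs I.pairs) [] (d.map some) [] e, o⟩
          ⟨r', memory (encodePairs I.pairs) [] (d.map some) [] e, o⟩ (checkTime k I.n) ∧
        r'.ok = I.good d := by
    intro d e o hd
    obtain ⟨r', hr, hok⟩ := runs_check I.pairs I.wellFormed_pairs d hd e o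
    refine ⟨r', hr.mono ?_, hok⟩
    have h1 := I.length_encodePairs_le
    have h2 := Nat.mul_le_mul_right (4 * I.n + 2 * 2 ^ k + 6) I.length_constraints_le
    rw [hlen, checkTime]
    omega
  have hrun := runs_solver hcheck (hcollect (encodePairs I.pairs)) init
  rw [← I.encode_eq] at hrun
  refine outputsWithin_machine (hrun.mono ?_)
  have h1 := I.length_encodePairs_le
  have h2 := Nat.mul_le_mul_right (checkTime k I.n + (4 * I.n + 4) + 15) (Instance.nodes_good_le hI)
  rw [solverTime]
  omega

/-- Replace the answer `false` by `true`. -/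
def accept : Prog Stack (Option Bool) Bool (Register k) :=
  .block [.drop, .emit fun _ => some true]

theorem runs_accept (r : Register k) (f : Stack → List (Option Bool)) (o : List Bool) :
    Runs accept ⟨r, f, o⟩ ⟨r, f, true :: o.tail⟩ 1 :=
  runs_block rfl

/-- Copy the assignment in `path` to the output stack. -/
def copyPath : Prog Stack (Option Bool) (Option Bool) (Register k) :=
  .seq (.block [.emit fun _ => some none]) <|
    .seq (.loop [pop .path] Register.nonempty (.block [pushCur .front, .emit fun r => r.cur]))
      (move .front .path)

theorem runs_copyPath (B : List (Option Bool)) (d : List Bool) (r : Register k)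
    (o : List (Option Bool)) :
    Runs copyPath ⟨r, memory B [] (d.map some) [] [], o⟩
      ⟨{ r with cur := none }, memory B [] (d.map some) [] [], encodeBits d.reverse ++ o⟩
      (4 * d.length + 4) := by
  have copy (d : List Bool) (r : Register k) (a o : List (Option Bool)) :
      Runs (.loop [pop .path] Register.nonempty (.block [pushCur .front, .emit fun r => r.cur]))
        ⟨r, memory B [] (d.map some) a [], o⟩
        ⟨{ r with cur := none }, memory B [] [] (d.reverse.map some ++ a) [],
          d.reverse.map some ++ o⟩ (2 * d.length + 1) := by
    induction d generalizing r a o with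
    | nil => exact runs_loop_exit (by simp [runOps, Op.run, pop]) rfl
    | cons b d ih =>
      have hw (l : List (Option Bool)) :
          (b :: d).reverse.map some ++ l = d.reverse.map some ++ some b :: l := by simp
      rw [hw, hw]
      refine (LoopSteps.single (s₁ := ⟨{ r with cur := some (some b) },
        memory B [] (d.map some) a [], o⟩) (by simp [runOps, Op.run, pop]) rfl
        (runs_block (by simp [runOps, Op.run, pushCur])) _ _
        (ih { r with cur := some (some b) } (some b :: a) (some b :: o))).mono
        (t := 1 + 1 + (2 * d.length + 1)) (by simp; omega)
  have back := runs_move_front_path B [] [] (d.reverse.map some) [] { r with cur := none }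
    (encodeBits d.reverse ++ o)
  have h := copy d r [] (none :: o)
  rw [List.append_nil] at h
  have ho : d.reverse.map some ++ none :: o = encodeBits d.reverse ++ o := by
    simp [encodeBits]
  rw [ho] at h
  have hd : (d.reverse.map some).reverse ++ [] = d.map (some : Bool → Option Bool) := by simp
  rw [hd] at back
  exact (Runs.seq (runs_block rfl) (h.seq back)).mono (by simp; omega)

theorem encodeAssignments_solutions (I : Instance k) :
    encodeAssignments I.solutions =
      (leaves I.good I.n []).flatMap fun d => encodeBits d.reverse := by
  rw [encodeAssignments, Instance.solutions, List.flatMap_map]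
  refine List.flatMap_congr fun d hd => ?_
  rw [I.ofFn_assignment (I.mem_leaves_iff.1 hd).2]

theorem satisfiable_iff_leaves (I : Instance k) :
    (!(leaves I.good I.n []).isEmpty) = true ↔ I.Satisfiable := by
  have h : I.Satisfiable ↔ I.solutions ≠ [] := by
    rw [← List.isEmpty_eq_false_iff, List.isEmpty_eq_false_iff_exists_mem]
    exact exists_congr fun α => (I.mem_solutions α).symm
  rw [h, Instance.solutions]
  simp

end CompleteCSP

open CompleteCSP in
/-- For every constant `k`, a multi-stack Turing machine decides the satisfiability of complete
Boolean `k`-CSP instances on `n` variables within `n ^ O(log n)` steps, and another one writes out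
all satisfying assignments, each exactly once, within `n ^ O(log n)` steps. -/
theorem theorem1 (k : ℕ) :
    (∃ (M : Turing.TM2ComputableAux (Option Bool) Bool) (T : ℕ → ℕ),
      IsPowBigOLog T ∧
      ∀ I : Instance k, I.Complete →
        ∃ b : Bool, (b = true ↔ I.Satisfiable) ∧ OutputsWithin M I.encode [b] (T I.n)) ∧
    (∃ (M : Turing.TM2ComputableAux (Option Bool) (Option Bool)) (T : ℕ → ℕ),
      IsPowBigOLog T ∧
      ∀ I : Instance k, I.Complete →
        ∃ L : List (Fin I.n → Bool), L.Nodup ∧ (∀ α, α ∈ L ↔ I.Satisfies α) ∧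
          OutputsWithin M I.encode (encodeAssignments L) (T I.n)) := by
  refine ⟨⟨machine (k := k) (solver (some false) accept), solverTime k, isPowBigOLog_solverTime k,
    fun I hI => ⟨_, satisfiable_iff_leaves I, ?_⟩⟩,
    ⟨machine (k := k) (solver none copyPath), solverTime k, isPowBigOLog_solverTime k,
    fun I hI => ⟨I.solutions, I.nodup_solutions, I.mem_solutions, ?_⟩⟩⟩
  · have h := runs_solver_of_complete hI (E := fun _ o => true :: o.tail)
      (fun B d r o _ => ⟨r, (runs_accept r _ o).mono (by omega)⟩) (some false)
    rwa [Option.toList_some, visit_accept, Bool.false_or] at h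
  · have h := runs_solver_of_complete hI (E := fun d o => encodeBits d.reverse ++ o)
      (fun B d r o hd => ⟨_, (runs_copyPath B d r o).mono (by omega)⟩) none
    rwa [visit_append, Option.toList_none, List.append_nil, ← encodeAssignments_solutions] at h
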